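/- Let the lattice $L$ be either the periodic lattice $\mathbb Z/N\mathbb Z$ with $N\ge 1$ (the periodic model) or $\mathbb Z$ (the unbounded model). A configuration is a map $X:L\to\{0,1\}$, where $X(x)=1$ means that there is a particle at $x$. The flow of slow particles is the map $T$ in which every particle simultaneously moves forward by one place if that place is empty and stays otherwise: $TX(x)=1$ if $X(x)=0$ and $X(x-1)=1$, or if $X(x)=1$ and $X(x+1)=1$; and $TX(x)=0$ otherwise. For $y\in L$ let $\tau_X^{\pm}y=y\pm d^{\pm}_X(y)$, where $d^{\pm}_X(y)=\min\{d\ge 1:\ X(y\pm d)=1\}$; thus $\tau^+_Xy$ (respectively $\tau^-_Xy$) is the position of the closest particle strictly in front of (respectively behind) $y$, in the cyclic sense when $L=\mathbb Z/N\mathbb Z$. The forward and backward passive tracer and the flow evolve by the skew products $\mathcal T_\pm(X,y)=(TX,\tau_X^{\pm}y)$. With $(X_s,y_s)=\mathcal T_\pm^{\,s}(X,y)$ put $S_\pm(t)=\pm\sum_{s=0}^{t-1}d^{\pm}_{X_s}(y_s)$; the average velocity of the tracer up to time $t\geq 1$ is $v_\pm(t)=S_\pm(t)/t$. In the periodic model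 let $m(X)$ be the number of particles of $X$ and $\rho=m(X)/N$. In the unbounded model $X$ is called regular with density $\rho\in\mathbb R$ if there is a monotone one-to-one function $\varphi$ of the nonnegative integers to $\mathbb R$ with $\varphi(n)\to0$ as $n\to\infty$ such that $$\left|\frac{\#\{x\in\{n+1,\dots,n+k\}:X(x)=1\}}{k}-\rho\right|\le\varphi(k)\qquad\text{for all } n\in\mathbb Z,\ k\ge 1 .$$ Theorem. Suppose that either $L=\mathbb Z/N\mathbb Z$ and $X$ is any configuration with $m(X)>1$, or $L=\mathbb Z$ and $X$ is regular with density $\rho\notin\{0,\tfrac12,1\}$. Then for every initial position $y\in L$ of the tracer, the motions of the forward and of the backward tracer are well defined for all times (the minima above are always over nonempty sets), and 1. if $\rho\le\frac12$, then $v_+(t)\to 1$ as $t\to\infty$; 2. (for every $\rho$ as above) $v_-(t)\to-\max\left(1,\frac1\rho-1\right)$ as $t\to\infty$. -/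

import Mathlib

open Filter Topology

namespace Traffic

/-- A configuration of particles on a lattice `L`: `X x = true` means that there is a particle at
`x`, and `X x = false` that the position `x` is empty.  The lattices of interest are `ZMod N`
(finite periodic lattice) and `ℤ` (unbounded lattice). -/
abbrev Config (L : Type*) := L → Bool

variable {L : Type*} [AddGroupWithOne L]

/-- The map `T` of the one-dimensional traffic model with slow particles: every particle moves
forward by one place if this place is empty, and stays where it is otherwise. -/
def slowMap (X : Config L) : Config L := fun x =>
  decide ((X x = false ∧ X (x - 1) = true) ∨ (X x = true ∧ X (x + 1) = true))

/-- The set of distances `d ≥ 1` at which there is a particle strictly in front of `y`. -/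
def forwardDistances (X : Config L) (y : L) : Set ℕ := {d | 0 < d ∧ X (y + (d : L)) = true}

/-- The set of distances `d ≥ 1` at which there is a particle strictly behind `y`. -/
def backwardDistances (X : Config L) (y : L) : Set ℕ := {d | 0 < d ∧ X (y - (d : L)) = true}

/-- Distance from `y` to the closest particle strictly in front of it (meaningful if there is such
a particle). -/
noncomputable def forwardJump (X : Config L) (y : L) : ℕ := sInf (forwardDistances X y)

/-- Distance from `y` to the closest particle strictly behind it (meaningful if there is such
a particle). -/
noncomputable def backwardJump (X : Config L) (y : L) : ℕ := sInf (backwardDistances X y)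

/-- The map `τ⁺_X`: the closest position of a particle strictly in front of `y`. -/
noncomputable def tauPlus (X : Config L) (y : L) : L := y + (forwardJump X y : L)

/-- The map `τ⁻_X`: the closest position of a particle strictly behind `y`. -/
noncomputable def tauMinus (X : Config L) (y : L) : L := y - (backwardJump X y : L)

/-- The skew product `(X, y) ↦ (T X, τ⁺_X y)`. -/
noncomputable def skewPlus (p : Config L × L) : Config L × L := (slowMap p.1, tauPlus p.1 p.2)

/-- The skew product `(X, y) ↦ (T X, τ⁻_X y)`. -/
noncomputable def skewMinus (p : Config L × L) : Config L × L := (slowMap p.1, tauMinus p.1 p.2)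

/-- At every moment there is a particle in front of the forward moving tracer, so that its motion
is well defined for all times. -/
def ForwardMotionDefined (X : Config L) (y : L) : Prop :=
  ∀ t : ℕ, (forwardDistances (skewPlus^[t] (X, y)).1 (skewPlus^[t] (X, y)).2).Nonempty

/-- At every moment there is a particle behind the backward moving tracer, so that its motion
is well defined for all times. -/
def BackwardMotionDefined (X : Config L) (y : L) : Prop :=
  ∀ t : ℕ, (backwardDistances (skewMinus^[t] (X, y)).1 (skewMinus^[t] (X, y)).2).Nonempty

/-- The total distance `S(t)` covered up to the moment `t` by the forward moving tracer. -/
noncomputable def forwardTravel (X : Config L) (y : L) (t : ℕ) : ℝ :=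
  ∑ s ∈ Finset.range t, (forwardJump (skewPlus^[s] (X, y)).1 (skewPlus^[s] (X, y)).2 : ℝ)

/-- The total distance covered up to the moment `t` by the backward moving tracer, taken with the
negative sign. -/
noncomputable def backwardTravel (X : Config L) (y : L) (t : ℕ) : ℝ :=
  -∑ s ∈ Finset.range t, (backwardJump (skewMinus^[s] (X, y)).1 (skewMinus^[s] (X, y)).2 : ℝ)

/-- The average (in time) velocity `S(t) / t` of the forward moving tracer. -/
noncomputable def forwardVelocity (X : Config L) (y : L) (t : ℕ) : ℝ := forwardTravel X y t / t

/-- The average (in time) velocity `S(t) / t` of the backward moving tracer. -/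
noncomputable def backwardVelocity (X : Config L) (y : L) (t : ℕ) : ℝ := backwardTravel X y t / t

/-- The number of particles `m(X)` of a configuration on the periodic lattice of size `N`. -/
def particles {N : ℕ} [NeZero N] (X : Config (ZMod N)) : ℕ :=
  (Finset.univ.filter fun x => X x = true).card

/-- The density `m(X) / N` of a configuration on the periodic lattice of size `N`. -/
noncomputable def density {N : ℕ} [NeZero N] (X : Config (ZMod N)) : ℝ := (particles X : ℝ) / N

/-- The number of particles of a configuration on `ℤ` at the positions `a, a + 1, …, b`. -/
noncomputable def particlesIn (X : Config ℤ) (a b : ℤ) : ℕ :=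
  ((Finset.Icc a b).filter fun x => X x = true).card

/-- The regularity assumption with density `ρ`: there is a monotone one-to-one rate function
`φ` tending to zero that bounds, uniformly in the position of the window, the deviation from `ρ`
of the density in windows of length `N ≥ 1`. -/
def Regular (X : Config ℤ) (ρ : ℝ) : Prop :=
  ∃ φ : ℕ → ℝ, (Monotone φ ∨ Antitone φ) ∧ Function.Injective φ ∧ Tendsto φ atTop (𝓝 0) ∧
    ∀ (n : ℤ) (N : ℕ), 0 < N → |(particlesIn X (n + 1) (n + N) : ℝ) / N - ρ| ≤ φ N

/-- On `ℤ`, `τ⁺_X y = min {x | y < x, X x = 1}`. -/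
theorem tauPlus_isLeast (X : Config ℤ) (y : ℤ) (h : ∃ x, y < x ∧ X x = true) :
    IsLeast {x | y < x ∧ X x = true} (tauPlus X y) := by
  obtain ⟨x, hx, hX⟩ := h
  have hne : (forwardDistances X y).Nonempty :=
    ⟨(x - y).toNat, by omega, by
      rw [show y + (((x - y).toNat : ℕ) : ℤ) = x by omega]; exact hX⟩
  have hm := Nat.sInf_mem hne
  refine ⟨⟨?_, hm.2⟩, fun z hz => ?_⟩
  · have := hm.1
    simp only [tauPlus, forwardJump]
    omega
  · have hz' : (z - y).toNat ∈ forwardDistances X y :=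
      ⟨by have := hz.1; omega, by
        rw [show y + (((z - y).toNat : ℕ) : ℤ) = z by have := hz.1; omega]; exact hz.2⟩
    have h1 := Nat.sInf_le hz'
    have h2 := hz.1
    simp only [tauPlus, forwardJump]
    omega

/-- On `ℤ`, `τ⁻_X y = max {x | x < y, X x = 1}`. -/
theorem tauMinus_isGreatest (X : Config ℤ) (y : ℤ) (h : ∃ x, x < y ∧ X x = true) :
    IsGreatest {x | x < y ∧ X x = true} (tauMinus X y) := by
  obtain ⟨x, hx, hX⟩ := h
  have hne : (backwardDistances X y).Nonempty :=
    ⟨(y - x).toNat, by omega, by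
      rw [show y - (((y - x).toNat : ℕ) : ℤ) = x by omega]; exact hX⟩
  have hm := Nat.sInf_mem hne
  refine ⟨⟨?_, hm.2⟩, fun z hz => ?_⟩
  · have := hm.1
    simp only [tauMinus, backwardJump]
    omega
  · have hz' : (y - z).toNat ∈ backwardDistances X y :=
      ⟨by have := hz.1; omega, by
        rw [show y - (((y - z).toNat : ℕ) : ℤ) = z by have := hz.1; omega]; exact hz.2⟩
    have h1 := Nat.sInf_le hz'
    have h2 := hz.1
    simp only [tauMinus, backwardJump]
    omega

end Traffic

/-! Integrate a configuration on `ℤ` to a height `H` that climbs by one at each particle. The flow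
becomes `H ↦ max (H (x - 1)) (H (x + 1) - 1)`, so after `t` steps there is a Hopf–Lax formula: the
height at `x` is the maximum over `0 ≤ j ≤ t` of `H (x - t + 2 * j) - j`. If every window of length
`K` is at most half full, comparing maximizers at `x` and `x + 2` excludes adjacent particles from
time `K` on (`IsHeight.no_adjacent_particles`). If every such window is at least half full, adjacent
holes are excluded.

From then on the flow is a rigid shift, to the right in the free case and to the left in the jammed
case. A forward tracer in the free phase, or a backward tracer in the jammed phase, is on a particle
and follows the shift, at speed one. A backward tracer in the free phase passes one particle per
unit of time in the moving frame (`height_backwardPos_of_free`). In that frame it covers about `s /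
ρ` in time `s`, so its velocity is `1 - 1 / ρ`.

The periodic model is unrolled to a periodic configuration on `ℤ`. One period is a window with
exactly `m(X)` particles, so there density `1 / 2` is allowed as well. -/

namespace Traffic

/-! ### Orbits and well-definedness on `ℤ` -/

section Orbits

variable {L : Type*} [AddGroupWithOne L]

theorem skewPlus_iterate_fst (X : Config L) (y : L) (t : ℕ) :
    (skewPlus^[t] (X, y)).1 = slowMap^[t] X := by
  induction t with
  | zero => rfl
  | succ t ih => rw [Function.iterate_succ_apply', Function.iterate_succ_apply', ← ih]; rfl

theorem skewMinus_iterate_fst (X : Config L) (y : L) (t : ℕ) :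
    (skewMinus^[t] (X, y)).1 = slowMap^[t] X := by
  induction t with
  | zero => rfl
  | succ t ih => rw [Function.iterate_succ_apply', Function.iterate_succ_apply', ← ih]; rfl

/-- The position of the forward tracer at time `t`. -/
noncomputable def forwardPos (X : Config L) (y : L) (t : ℕ) : L := (skewPlus^[t] (X, y)).2

/-- The position of the backward tracer at time `t`. -/
noncomputable def backwardPos (X : Config L) (y : L) (t : ℕ) : L := (skewMinus^[t] (X, y)).2

theorem forwardPos_succ (X : Config L) (y : L) (t : ℕ) :
    forwardPos X y (t + 1) = tauPlus (slowMap^[t] X) (forwardPos X y t) := by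
  rw [← skewPlus_iterate_fst X y t, forwardPos, Function.iterate_succ_apply']; rfl

theorem backwardPos_succ (X : Config L) (y : L) (t : ℕ) :
    backwardPos X y (t + 1) = tauMinus (slowMap^[t] X) (backwardPos X y t) := by
  rw [← skewMinus_iterate_fst X y t, backwardPos, Function.iterate_succ_apply']; rfl

end Orbits

/-- The jumps telescope on `ℤ`, whereas positions in `ZMod N` forget complete turns. -/
theorem forwardTravel_eq (X : Config ℤ) (y : ℤ) (t : ℕ) :
    forwardTravel X y t = ((forwardPos X y t : ℤ) : ℝ) - y := by
  induction t with
  | zero => simp [forwardTravel, forwardPos]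
  | succ t ih =>
    have h : forwardTravel X y (t + 1) = forwardTravel X y t +
        (forwardJump (slowMap^[t] X) (forwardPos X y t) : ℝ) := by
      rw [forwardTravel, Finset.sum_range_succ, skewPlus_iterate_fst]; rfl
    rw [h, ih, forwardPos_succ, tauPlus]
    push_cast
    ring

theorem backwardTravel_eq (X : Config ℤ) (y : ℤ) (t : ℕ) :
    backwardTravel X y t = ((backwardPos X y t : ℤ) : ℝ) - y := by
  induction t with
  | zero => simp [backwardTravel, backwardPos]
  | succ t ih =>
    have h : backwardTravel X y (t + 1) = backwardTravel X y t -
        (backwardJump (slowMap^[t] X) (backwardPos X y t) : ℝ) := by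
      rw [backwardTravel, Finset.sum_range_succ, neg_add, skewMinus_iterate_fst]; rfl
    rw [h, ih, backwardPos_succ, tauMinus]
    push_cast
    ring

/-- There are particles arbitrarily far in both directions. -/
def TwoSided (X : Config ℤ) : Prop :=
  ∀ y, (∃ x, y < x ∧ X x = true) ∧ ∃ x, x < y ∧ X x = true

theorem slowMap_particle {X : Config ℤ} {x : ℤ} (h : X x = true) :
    slowMap X x = true ∨ slowMap X (x + 1) = true := by
  simp only [slowMap, decide_eq_true_eq, add_sub_cancel_right]
  cases h' : X (x + 1) <;> simp [h]

theorem TwoSided.slowMap {X : Config ℤ} (h : TwoSided X) : TwoSided (slowMap X) := by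
  intro y
  obtain ⟨x, hx, hX⟩ := (h y).1
  -- Searching behind `y - 1` leaves room for the particle to advance by one place.
  obtain ⟨z, hz, hZ⟩ := (h (y - 1)).2
  refine ⟨?_, ?_⟩
  · rcases slowMap_particle hX with h1 | h1
    exacts [⟨x, hx, h1⟩, ⟨x + 1, by omega, h1⟩]
  · rcases slowMap_particle hZ with h1 | h1
    exacts [⟨z, by omega, h1⟩, ⟨z + 1, by omega, h1⟩]

theorem TwoSided.iterate {X : Config ℤ} (h : TwoSided X) (t : ℕ) :
    TwoSided (Traffic.slowMap^[t] X) := by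
  induction t with
  | zero => exact h
  | succ t ih => rw [Function.iterate_succ_apply']; exact ih.slowMap

theorem TwoSided.forwardMotionDefined {X : Config ℤ} (h : TwoSided X) (y : ℤ) :
    ForwardMotionDefined X y := by
  intro t
  rw [skewPlus_iterate_fst]
  obtain ⟨x, hx, hX⟩ := (h.iterate t (skewPlus^[t] (X, y)).2).1
  refine ⟨(x - (skewPlus^[t] (X, y)).2).toNat, by omega, ?_⟩
  rw [Int.toNat_of_nonneg (by omega), add_sub_cancel]
  exact hX

theorem TwoSided.backwardMotionDefined {X : Config ℤ} (h : TwoSided X) (y : ℤ) :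
    BackwardMotionDefined X y := by
  intro t
  rw [skewMinus_iterate_fst]
  obtain ⟨x, hx, hX⟩ := (h.iterate t (skewMinus^[t] (X, y)).2).2
  refine ⟨((skewMinus^[t] (X, y)).2 - x).toNat, by omega, ?_⟩
  rw [Int.toNat_of_nonneg (by omega), sub_sub_cancel]
  exact hX

theorem TwoSided.isLeast_forwardPos {X : Config ℤ} (h : TwoSided X) (y : ℤ) (t : ℕ) :
    IsLeast {x | forwardPos X y t < x ∧ Traffic.slowMap^[t] X x = true}
      (forwardPos X y (t + 1)) := by
  rw [forwardPos_succ]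
  exact tauPlus_isLeast _ _ (h.iterate t _).1

theorem TwoSided.isGreatest_backwardPos {X : Config ℤ} (h : TwoSided X) (y : ℤ) (t : ℕ) :
    IsGreatest {x | x < backwardPos X y t ∧ Traffic.slowMap^[t] X x = true}
      (backwardPos X y (t + 1)) := by
  rw [backwardPos_succ]
  exact tauMinus_isGreatest _ _ (h.iterate t _).2

/-! ### Height functions -/

/-- `H` is a height function of `X`: it increases by one at every particle and is constant
otherwise. -/
def IsHeight (X : Config ℤ) (H : ℤ → ℤ) : Prop :=
  ∀ x, H (x + 1) = H x + if X (x + 1) = true then 1 else 0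

/-- The evolution of height functions induced by `slowMap`. -/
def heightStep (H : ℤ → ℤ) : ℤ → ℤ := fun x => max (H (x - 1)) (H (x + 1) - 1)

/-- The height at `x` drops by one exactly when a particle jumps from `x` to `x + 1`, and this is
what the maximum in `heightStep` records. -/
theorem IsHeight.slowMap {X : Config ℤ} {H : ℤ → ℤ} (h : IsHeight X H) :
    IsHeight (slowMap X) (heightStep H) := by
  intro x
  have h1 := h (x - 1)
  have h2 := h x
  have h3 := h (x + 1)
  simp only [sub_add_cancel] at h1
  simp only [heightStep, Traffic.slowMap, decide_eq_true_eq, add_sub_cancel_right]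
  cases ha : X x <;> cases hb : X (x + 1) <;> cases hc : X (x + 1 + 1) <;>
    simp only [ha, hb, hc, Bool.false_eq_true, if_true, if_false, true_and, false_and,
      or_true, or_false, reduceCtorEq] at h1 h2 h3 ⊢ <;> omega

theorem IsHeight.iterate {X : Config ℤ} {H : ℤ → ℤ} (h : IsHeight X H) (t : ℕ) :
    IsHeight (Traffic.slowMap^[t] X) (heightStep^[t] H) := by
  induction t with
  | zero => exact h
  | succ t ih =>
    rw [Function.iterate_succ_apply', Function.iterate_succ_apply']; exact ih.slowMap

/-! ### Hopf–Lax formula and the disappearance of adjacent particles or holes -/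

/-- Unfolding the maxima gives paths of `t` unit steps from `x`; `j` counts the steps to the right,
each of which costs one. -/
theorem le_heightStep_iterate (H : ℤ → ℤ) (t : ℕ) : ∀ (x : ℤ) (j : ℕ), j ≤ t →
    H (x - t + 2 * j) - j ≤ heightStep^[t] H x := by
  induction t with
  | zero => intro x j hj; obtain rfl : j = 0 := by omega
            simp
  | succ t ih =>
    intro x j hj
    rw [Function.iterate_succ_apply', heightStep]
    rcases Nat.lt_or_ge t j with h | h
    · obtain ⟨i, rfl⟩ : ∃ i, j = i + 1 := ⟨j - 1, by omega⟩
      have := ih (x + 1) i (by omega)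
      rw [show x + 1 - (t : ℤ) + 2 * i = x - ((t + 1 : ℕ) : ℤ) + 2 * ((i + 1 : ℕ) : ℤ) by
        push_cast; ring] at this
      refine le_max_of_le_right ?_
      push_cast at this ⊢
      omega
    · have := ih (x - 1) j h
      rw [show x - 1 - (t : ℤ) + 2 * j = x - ((t + 1 : ℕ) : ℤ) + 2 * j by push_cast; ring] at this
      exact le_max_of_le_left this

theorem exists_heightStep_iterate_eq (H : ℤ → ℤ) (t : ℕ) : ∀ x : ℤ, ∃ j : ℕ, j ≤ t ∧
    heightStep^[t] H x = H (x - t + 2 * j) - j := by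
  induction t with
  | zero => exact fun x => ⟨0, le_rfl, by simp⟩
  | succ t ih =>
    intro x
    rw [Function.iterate_succ_apply', heightStep]
    rcases max_choice (heightStep^[t] H (x - 1)) (heightStep^[t] H (x + 1) - 1) with h | h
    · obtain ⟨j, hj, e⟩ := ih (x - 1)
      refine ⟨j, by omega, ?_⟩
      rw [h, e]
      congr 2
      push_cast
      ring
    · obtain ⟨j, hj, e⟩ := ih (x + 1)
      refine ⟨j + 1, by omega, ?_⟩
      rw [h, e, show x + 1 - (t : ℤ) + 2 * j = x - ((t + 1 : ℕ) : ℤ) + 2 * ((j + 1 : ℕ) : ℤ) by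
        push_cast; ring]
      push_cast
      ring

theorem IsHeight.add_two {X : Config ℤ} {H : ℤ → ℤ} (h : IsHeight X H) (x : ℤ) :
    H (x + 2) = H x + (if X (x + 1) = true then 1 else 0) +
      if X (x + 2) = true then 1 else 0 := by
  have h1 := h x
  have h2 := h (x + 1)
  rw [add_assoc, one_add_one_eq_two] at h2
  rw [h2, h1]

theorem IsHeight.no_adjacent_particles {X : Config ℤ} {H : ℤ → ℤ} (h : IsHeight X H) {K : ℕ}
    (hH : ∀ n, H (n + 2 * K) ≤ H n + K) {t : ℕ} (hK : 0 < K) (ht : K ≤ t) (x : ℤ) :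
    ¬ (Traffic.slowMap^[t] X (x + 1) = true ∧ Traffic.slowMap^[t] X (x + 2) = true) := by
  rintro ⟨h1, h2⟩
  have e := (h.iterate t).add_two x
  rw [if_pos h1, if_pos h2] at e
  obtain ⟨j, hj, ej⟩ := exists_heightStep_iterate_eq H t (x + 2)
  -- For `j < t` the maximizing end point is also reached from `x`, with one more step to the right.
  -- For `j = t` it is out of reach from `x`, and the point `2 * K` to its left replaces it: the
  -- height loses at most `K` and the cost falls by `K - 1`.
  rcases hj.lt_or_eq with hj | rfl
  · have := le_heightStep_iterate H t x (j + 1) hj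
    rw [show x - (t : ℤ) + 2 * ((j + 1 : ℕ) : ℤ) = x + 2 - t + 2 * j by push_cast; ring] at this
    push_cast at this
    omega
  · have := le_heightStep_iterate H j x (j + 1 - K) (by omega)
    have hn := hH (x - j + 2 * ((j + 1 - K : ℕ) : ℤ))
    rw [Nat.cast_sub (by omega)] at hn this
    rw [show x - (j : ℤ) + 2 * (((j + 1 : ℕ) : ℤ) - K) + 2 * K = x + 2 - j + 2 * j by
      push_cast; ring] at hn
    push_cast at *
    omega

theorem IsHeight.no_adjacent_holes {X : Config ℤ} {H : ℤ → ℤ} (h : IsHeight X H) {K : ℕ}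
    (hH : ∀ n, H n + K ≤ H (n + 2 * K)) {t : ℕ} (hK : 0 < K) (ht : K ≤ t) (x : ℤ) :
    ¬ (Traffic.slowMap^[t] X (x + 1) = false ∧ Traffic.slowMap^[t] X (x + 2) = false) := by
  rintro ⟨h1, h2⟩
  have e := (h.iterate t).add_two x
  simp only [h1, h2, Bool.false_eq_true, if_false, add_zero] at e
  obtain ⟨j, hj, ej⟩ := exists_heightStep_iterate_eq H t x
  -- For `j > 0` the maximizing end point is reached from `x + 2` with one step to the right fewer.
  -- For `j = 0` the point `2 * K` to its right serves: the height gains at least `K` at cost `K -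
  -- 1`.
  rcases Nat.eq_zero_or_pos j with rfl | hj0
  · have := le_heightStep_iterate H t (x + 2) (K - 1) (by omega)
    have hn := hH (x - t)
    rw [Nat.cast_sub (by omega), show x + 2 - (t : ℤ) + 2 * ((K : ℤ) - (1 : ℕ)) = x - t + 2 * K by
      push_cast; ring] at this
    simp only [Nat.cast_zero, mul_zero, add_zero] at ej
    omega
  · have := le_heightStep_iterate H t (x + 2) (j - 1) (by omega)
    rw [Nat.cast_sub (by omega), show x + 2 - (t : ℤ) + 2 * ((j : ℤ) - (1 : ℕ)) = x - t + 2 * j by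
      push_cast; ring] at this
    omega

/-! ### Heights and particle counts -/

theorem IsHeight.particlesIn_eq {X : Config ℤ} {H : ℤ → ℤ} (h : IsHeight X H) (n : ℤ) (k : ℕ) :
    (particlesIn X (n + 1) (n + k) : ℤ) = H (n + k) - H n := by
  induction k with
  | zero => simp [particlesIn]
  | succ k ih =>
    have hI : Finset.Icc (n + 1) (n + ((k + 1 : ℕ) : ℤ)) =
        insert (n + k + 1) (Finset.Icc (n + 1) (n + k)) := by
      ext x
      simp only [Finset.mem_Icc, Finset.mem_insert]
      push_cast
      omega
    have hs := h (n + k)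
    rw [show n + ((k + 1 : ℕ) : ℤ) = n + k + 1 by push_cast; ring] at hI ⊢
    rw [hs]
    rw [particlesIn] at ih ⊢
    rw [hI, Finset.filter_insert]
    split_ifs with hX
    · rw [Finset.card_insert_of_notMem (by simp)]
      push_cast
      omega
    · omega

theorem exists_isHeight (X : Config ℤ) : ∃ H, IsHeight X H := by
  have key : ∀ a b : ℤ, a ≤ b → (particlesIn X a b : ℤ) =
      particlesIn X (a + 1) b + if X a = true then 1 else 0 := by
    intro a b hab
    have : Finset.Icc a b = insert a (Finset.Icc (a + 1) b) := by
      ext x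
      simp only [Finset.mem_Icc, Finset.mem_insert]
      omega
    rw [particlesIn, particlesIn, this, Finset.filter_insert]
    split_ifs
    · rw [Finset.card_insert_of_notMem (by simp)]
      push_cast
      rfl
    · simp
  have key' : ∀ a b : ℤ, a ≤ b + 1 → (particlesIn X a (b + 1) : ℤ) =
      particlesIn X a b + if X (b + 1) = true then 1 else 0 := by
    intro a b hab
    have : Finset.Icc a (b + 1) = insert (b + 1) (Finset.Icc a b) := by
      ext x
      simp only [Finset.mem_Icc, Finset.mem_insert]
      omega
    rw [particlesIn, particlesIn, this, Finset.filter_insert]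
    split_ifs
    · rw [Finset.card_insert_of_notMem (by simp)]
      push_cast
      rfl
    · simp
  have emp : ∀ a b : ℤ, b < a → particlesIn X a b = 0 := by
    intro a b hab
    simp [particlesIn, Finset.Icc_eq_empty_of_lt hab]
  -- A signed count from the origin; for each `x` at least one of the two windows is empty.
  refine ⟨fun x => particlesIn X 1 x - particlesIn X (x + 1) 0, fun x => ?_⟩
  rcases le_or_gt 0 x with hx | hx
  · have := key' 1 x (by omega)
    simp only [emp (x + 1) 0 (by omega), emp (x + 1 + 1) 0 (by omega)]
    omega
  · have := key (x + 1) 0 (by omega)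
    simp only [emp 1 x (by omega), emp 1 (x + 1) (by omega)]
    omega

theorem IsHeight.add_natCast_le {X : Config ℤ} {H : ℤ → ℤ} (h : IsHeight X H) (x : ℤ) (k : ℕ) :
    H x ≤ H (x + k) ∧ H (x + k) ≤ H x + k := by
  induction k with
  | zero => simp
  | succ k ih =>
    have := h (x + k)
    rw [add_assoc] at this
    push_cast
    split_ifs at this <;> omega

theorem IsHeight.abs_iterate_sub_le {X : Config ℤ} {H : ℤ → ℤ} (h : IsHeight X H) (t : ℕ)
    (x : ℤ) : |heightStep^[t] H x - H x| ≤ t := by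
  induction t with
  | zero => simp
  | succ t ih =>
    rw [Function.iterate_succ_apply']
    have h1 := h.iterate t (x - 1)
    have h2 := h.iterate t x
    rw [sub_add_cancel] at h1
    rw [heightStep]
    rw [abs_le] at ih ⊢
    push_cast
    split_ifs at h1 h2 <;> omega

/-- A height function is constant between two positions without particles in between. -/
theorem IsHeight.eq_of_no_particles {X : Config ℤ} {H : ℤ → ℤ} (h : IsHeight X H) {a b : ℤ}
    (hab : a ≤ b) (hX : ∀ x, a < x → x ≤ b → X x = false) : H b = H a := by
  induction b, hab using Int.leInduction with
  | base => rfl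
  | succ b hb ih =>
    rw [h b, hX (b + 1) (by omega) le_rfl, ih fun x h1 h2 => hX x h1 (by omega)]
    simp

/-! ### Free flow -/

theorem slowMap_eq_of_no_adjacent_particles {X : Config ℤ}
    (h : ∀ x, ¬ (X (x + 1) = true ∧ X (x + 2) = true)) (x : ℤ) : slowMap X x = X (x - 1) := by
  have h1 := h (x - 1)
  have h2 := h (x - 2)
  rw [sub_add_cancel, show x - 1 + 2 = x + 1 by ring] at h1
  rw [sub_add_cancel, show x - 2 + 1 = x - 1 by ring] at h2
  rw [slowMap]
  cases ha : X (x - 1) <;> cases hb : X x <;> cases hc : X (x + 1) <;> simp_all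

/-- Every hole has a particle right behind it, which fills it, so the pattern of holes moves back by
one place. -/
theorem slowMap_eq_of_no_adjacent_holes {X : Config ℤ}
    (h : ∀ x, ¬ (X (x + 1) = false ∧ X (x + 2) = false)) (x : ℤ) : slowMap X x = X (x + 1) := by
  have h1 := h (x - 1)
  have h2 := h (x - 2)
  rw [sub_add_cancel, show x - 1 + 2 = x + 1 by ring] at h1
  rw [sub_add_cancel, show x - 2 + 1 = x - 1 by ring] at h2
  rw [slowMap]
  cases ha : X (x - 1) <;> cases hb : X x <;> cases hc : X (x + 1) <;> simp_all

/-- The tracer at time `t + 1` stands where the configuration of time `t` has a particle. The shift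
puts that particle one place ahead, where it is the nearest target. The offset `K + 1` ensures that
this configuration is already free. -/
theorem forwardPos_of_free {X : Config ℤ} (hX : TwoSided X) (y : ℤ) {K : ℕ}
    (hfree : ∀ t, K ≤ t → ∀ x, slowMap^[t + 1] X x = slowMap^[t] X (x - 1)) (s : ℕ) :
    forwardPos X y (K + 1 + s) = forwardPos X y (K + 1) + s := by
  induction s with
  | zero => simp
  | succ s ih =>
    have h1 := (hX.isLeast_forwardPos y (K + s)).1.2
    obtain ⟨⟨h2, -⟩, h3⟩ := hX.isLeast_forwardPos y (K + s + 1)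
    have h4 : forwardPos X y (K + s + 1) + 1 ∈ {x | forwardPos X y (K + s + 1) < x ∧
        slowMap^[K + s + 1] X x = true} := by
      refine ⟨by omega, ?_⟩
      rw [hfree _ (by omega), add_sub_cancel_right]
      exact h1
    have h5 := h3 h4
    rw [show K + 1 + s = K + s + 1 by ring] at ih
    rw [show K + 1 + (s + 1) = K + s + 1 + 1 by ring]
    push_cast
    omega

theorem backwardPos_of_jammed {X : Config ℤ} (hX : TwoSided X) (y : ℤ) {K : ℕ}
    (hfree : ∀ t, K ≤ t → ∀ x, slowMap^[t + 1] X x = slowMap^[t] X (x + 1)) (s : ℕ) :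
    backwardPos X y (K + 1 + s) = backwardPos X y (K + 1) - s := by
  induction s with
  | zero => simp
  | succ s ih =>
    have h1 := (hX.isGreatest_backwardPos y (K + s)).1.2
    obtain ⟨⟨h2, -⟩, h3⟩ := hX.isGreatest_backwardPos y (K + s + 1)
    have h4 : backwardPos X y (K + s + 1) - 1 ∈ {x | x < backwardPos X y (K + s + 1) ∧
        slowMap^[K + s + 1] X x = true} := by
      refine ⟨by omega, ?_⟩
      rw [hfree _ (by omega), sub_add_cancel]
      exact h1
    have h5 := h3 h4
    rw [show K + 1 + s = K + s + 1 by ring] at ih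
    rw [show K + 1 + (s + 1) = K + s + 1 + 1 by ring]
    push_cast
    omega

theorem iterate_of_free {X : Config ℤ} {K : ℕ}
    (hfree : ∀ t, K ≤ t → ∀ x, slowMap^[t + 1] X x = slowMap^[t] X (x - 1)) (s : ℕ) :
    ∀ x, slowMap^[K + s] X x = slowMap^[K] X (x - s) := by
  induction s with
  | zero => simp
  | succ s ih =>
    intro x
    rw [← add_assoc, hfree _ (by omega), ih, sub_sub, Nat.cast_add_one, add_comm (s : ℤ)]

/-- In the free phase the backward tracer passes exactly one particle per unit of time, in the
frame that moves with the flow. -/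
theorem height_backwardPos_of_free {X : Config ℤ} (hX : TwoSided X) (y : ℤ) {K : ℕ}
    (hfree : ∀ t, K ≤ t → ∀ x, slowMap^[t + 1] X x = slowMap^[t] X (x - 1))
    (hadj : ∀ x, ¬ (slowMap^[K] X (x + 1) = true ∧ slowMap^[K] X (x + 2) = true))
    {H : ℤ → ℤ} (hH : IsHeight (slowMap^[K] X) H) (s : ℕ) :
    H (backwardPos X y (K + 1 + s) - s) = H (backwardPos X y (K + 1)) - s := by
  induction s with
  | zero => simp
  | succ s ih =>
    have h1 := (hX.isGreatest_backwardPos y (K + s)).1.2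
    obtain ⟨⟨h2, h2'⟩, h3⟩ := hX.isGreatest_backwardPos y (K + s + 1)
    rw [show K + 1 + s = K + s + 1 by ring] at ih
    rw [show K + 1 + (s + 1) = K + s + 1 + 1 by ring]
    rw [iterate_of_free hfree] at h1
    rw [add_assoc K, iterate_of_free hfree, ← add_assoc K] at h2'
    set p := backwardPos X y (K + s + 1) with hp
    set q := backwardPos X y (K + s + 1 + 1) with hq
    -- In the frame of the configuration at time `K`, the tracer goes from the particle at `p - s`
    -- to the one at `q - (s + 1)`; no particle lies strictly between.
    have hlt : q - ((s + 1 : ℕ) : ℤ) < p - s - 1 := by push_cast; omega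
    have hconst : H (p - s - 1) = H (q - ((s + 1 : ℕ) : ℤ)) := by
      refine hH.eq_of_no_particles hlt.le fun x hx1 hx2 => ?_
      rcases hx2.lt_or_eq with hx2 | rfl
      · by_contra hne
        have hm : x + ((s + 1 : ℕ) : ℤ) ∈ {x | x < p ∧ slowMap^[K + s + 1] X x = true} := by
          refine ⟨by push_cast; omega, ?_⟩
          rw [add_assoc K, iterate_of_free hfree, add_sub_cancel_right]
          simpa using hne
        have := h3 hm
        omega
      -- This site is the tracer's own position `p`, on which the maximality of `q` is silent; it is
      -- empty because it lies just behind a particle.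
      · have := hadj (p - s - 2)
        rw [sub_add_cancel, show p - (s : ℤ) - 2 + 1 = p - s - 1 by ring] at this
        simpa [h1] using this
    have hstep := hH (p - s - 1)
    rw [sub_add_cancel, if_pos h1] at hstep
    push_cast at *
    omega

/-! ### Limits on `ℤ` -/

/-- A finite transient and a constant offset do not affect an average velocity. -/
theorem tendsto_const_add_div (c : ℝ) (K : ℕ) {u : ℕ → ℝ} {a : ℝ}
    (h : Tendsto (fun s : ℕ => u s / s) atTop (𝓝 a)) (v : ℕ → ℝ)
    (hv : ∀ s, v (K + s) = c + u s) : Tendsto (fun t : ℕ => v t / t) atTop (𝓝 a) := by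
  rw [← tendsto_add_atTop_iff_nat K]
  have h1 : Tendsto (fun s : ℕ => c / (s : ℝ)) atTop (𝓝 0) :=
    tendsto_const_div_atTop_nhds_zero_nat c
  have h2 : Tendsto (fun s : ℕ => 1 + (K : ℝ) / (s : ℝ)) atTop (𝓝 1) := by
    simpa using (tendsto_const_div_atTop_nhds_zero_nat (K : ℝ)).const_add 1
  have h3 := (h1.add h).div h2 one_ne_zero
  rw [zero_add, div_one] at h3
  refine h3.congr' ?_
  filter_upwards [eventually_gt_atTop 0] with s hs
  have hs' : (s : ℝ) ≠ 0 := by positivity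
  have hs2 : (s : ℝ) + K ≠ 0 := by positivity
  simp only [Pi.div_apply]
  rw [add_comm s K, hv]
  push_cast
  rw [add_comm (K : ℝ) s]
  field_simp

/-- The density of `X` in windows of length `k` tends to `ρ`, uniformly in the position. -/
def UniformDensity (X : Config ℤ) (ρ : ℝ) : Prop :=
  ∃ φ : ℕ → ℝ, Tendsto φ atTop (𝓝 0) ∧
    ∀ (n : ℤ) (k : ℕ), 0 < k → |(particlesIn X (n + 1) (n + k) : ℝ) / k - ρ| ≤ φ k

theorem UniformDensity.twoSided {X : Config ℤ} {ρ : ℝ} (h : UniformDensity X ρ) (hρ : 0 < ρ) :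
    TwoSided X := by
  obtain ⟨φ, hφ, hX⟩ := h
  obtain ⟨k, hk, hk0⟩ := ((hφ.eventually (gt_mem_nhds hρ)).and (eventually_gt_atTop 0)).exists
  have key : ∀ n : ℤ, ∃ x, n < x ∧ x ≤ n + k ∧ X x = true := by
    intro n
    by_contra! hne
    have h0 : particlesIn X (n + 1) (n + k) = 0 := by
      rw [particlesIn, Finset.card_eq_zero, Finset.filter_eq_empty_iff]
      intro x hx
      rw [Finset.mem_Icc] at hx
      exact hne x (by omega) hx.2
    have := hX n k hk0
    rw [h0, Nat.cast_zero, zero_div, zero_sub, abs_neg, abs_of_pos hρ] at this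
    linarith
  intro y
  obtain ⟨x, h1, -, h2⟩ := key y
  obtain ⟨z, -, h3, h4⟩ := key (y - 1 - k)
  exact ⟨⟨x, h1, h2⟩, z, by omega, h4⟩

/-- Two consecutive windows of length `K` make one of even length `2 * K`, as the parity of `x - t +
2 * j` requires. -/
theorem eventually_free {X : Config ℤ} {K : ℕ} (hK : 0 < K)
    (h : ∀ n : ℤ, 2 * particlesIn X (n + 1) (n + K) ≤ K) (t : ℕ) (ht : K ≤ t) (x : ℤ) :
    ¬ (slowMap^[t] X (x + 1) = true ∧ slowMap^[t] X (x + 2) = true) := by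
  obtain ⟨H, hH⟩ := exists_isHeight X
  refine hH.no_adjacent_particles (fun n => ?_) hK ht x
  have h1 := hH.particlesIn_eq n K
  have h2 := hH.particlesIn_eq (n + K) K
  have h3 := h n
  have h4 := h (n + K)
  rw [show n + 2 * (K : ℤ) = n + K + K by ring]
  omega

theorem eventually_jammed {X : Config ℤ} {K : ℕ} (hK : 0 < K)
    (h : ∀ n : ℤ, K ≤ 2 * particlesIn X (n + 1) (n + K)) (t : ℕ) (ht : K ≤ t) (x : ℤ) :
    ¬ (slowMap^[t] X (x + 1) = false ∧ slowMap^[t] X (x + 2) = false) := by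
  obtain ⟨H, hH⟩ := exists_isHeight X
  refine hH.no_adjacent_holes (fun n => ?_) hK ht x
  have h1 := hH.particlesIn_eq n K
  have h2 := hH.particlesIn_eq (n + K) K
  have h3 := h n
  have h4 := h (n + K)
  rw [show n + 2 * (K : ℤ) = n + K + K by ring]
  omega

theorem tendsto_forwardVelocity {X : Config ℤ} (hX : TwoSided X) {K : ℕ} (hK : 0 < K)
    (h : ∀ n : ℤ, 2 * particlesIn X (n + 1) (n + K) ≤ K) (y : ℤ) :
    Tendsto (forwardVelocity X y) atTop (𝓝 1) := by
  have hfree : ∀ t, K ≤ t → ∀ x, slowMap^[t + 1] X x = slowMap^[t] X (x - 1) := by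
    intro t ht x
    rw [Function.iterate_succ_apply']
    exact slowMap_eq_of_no_adjacent_particles (eventually_free hK h t ht) x
  refine tendsto_const_add_div (forwardPos X y (K + 1) - y) (K + 1) (u := fun s => s) ?_
    (forwardTravel X y) fun s => ?_
  · refine tendsto_const_nhds.congr' ?_
    filter_upwards [eventually_gt_atTop 0] with s hs
    rw [div_self (by positivity)]
  · rw [forwardTravel_eq, forwardPos_of_free hX y hfree]
    push_cast
    ring

theorem tendsto_backwardVelocity_of_jammed {X : Config ℤ} (hX : TwoSided X) {K : ℕ} (hK : 0 < K)
    (h : ∀ n : ℤ, K ≤ 2 * particlesIn X (n + 1) (n + K)) (y : ℤ) :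
    Tendsto (backwardVelocity X y) atTop (𝓝 (-1)) := by
  have hfree : ∀ t, K ≤ t → ∀ x, slowMap^[t + 1] X x = slowMap^[t] X (x + 1) := by
    intro t ht x
    rw [Function.iterate_succ_apply']
    exact slowMap_eq_of_no_adjacent_holes (eventually_jammed hK h t ht) x
  refine tendsto_const_add_div (backwardPos X y (K + 1) - y) (K + 1) (u := fun s => -s) ?_
    (backwardTravel X y) fun s => ?_
  · refine tendsto_const_nhds.congr' ?_
    filter_upwards [eventually_gt_atTop 0] with s hs
    rw [neg_div, div_self (by positivity)]
  · rw [backwardTravel_eq, backwardPos_of_jammed hX y hfree]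
    push_cast
    ring

theorem tendsto_backwardVelocity_of_free {X : Config ℤ} {ρ : ℝ} (hρ : 0 < ρ)
    (hd : UniformDensity X ρ) {K : ℕ} (hK : 0 < K)
    (h : ∀ n : ℤ, 2 * particlesIn X (n + 1) (n + K) ≤ K) (y : ℤ) :
    Tendsto (backwardVelocity X y) atTop (𝓝 (-(1 / ρ - 1))) := by
  have hX := hd.twoSided hρ
  have hadj := eventually_free hK h
  have hfree : ∀ t, K ≤ t → ∀ x, slowMap^[t + 1] X x = slowMap^[t] X (x - 1) := by
    intro t ht x
    rw [Function.iterate_succ_apply']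
    exact slowMap_eq_of_no_adjacent_particles (hadj t ht) x
  obtain ⟨H, hH⟩ := exists_isHeight X
  have hHK := hH.iterate K
  have hpos := height_backwardPos_of_free hX y hfree (hadj K le_rfl) hHK
  set p : ℤ := backwardPos X y (K + 1) with hp
  -- Position of the tracer in the frame moving with the free flow.
  set w : ℕ → ℤ := fun s => backwardPos X y (K + 1 + s) - s with hw
  have hwlt : ∀ s, w s ≤ p - s := by
    intro s
    have h1 : w s ≤ p := by
      induction s with
      | zero => simp [hw, hp]
      | succ s ih =>
        have := (hX.isGreatest_backwardPos y (K + 1 + s)).1.1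
        simp only [hw] at ih ⊢
        rw [← add_assoc]
        push_cast
        omega
    -- The height falls by `s` and has slope at most one, so the distance is at least `s`.
    have h2 := hHK.add_natCast_le (w s) (p - w s).toNat
    rw [Int.toNat_of_nonneg (by omega), add_sub_cancel] at h2
    have h3 := hpos s
    change heightStep^[K] H (w s) = _ at h3
    omega
  set D : ℕ → ℕ := fun s => (p - w s).toNat with hD
  have hDw : ∀ s, ((D s : ℕ) : ℤ) = p - w s := fun s =>
    Int.toNat_of_nonneg (by have := hwlt s; omega)
  have hDs : ∀ s, s ≤ D s := fun s => by have := hwlt s; have := hDw s; omega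
  have hDtop : Tendsto D atTop atTop := tendsto_atTop_mono hDs tendsto_id
  obtain ⟨φ, hφ, hdens⟩ := hd
  set M : ℕ → ℕ := fun s => particlesIn X (w s + 1) (w s + D s) with hM
  -- The density hypothesis concerns `X`, while the exact count `s` concerns the configuration at
  -- time `K`; the two heights differ by at most `K` at either end of the window.
  have hMs : ∀ s, |(M s : ℤ) - s| ≤ 2 * K := by
    intro s
    have h1 := hH.particlesIn_eq (w s) (D s)
    have h2 := hpos s
    change heightStep^[K] H (w s) = _ at h2
    have h3 := hH.abs_iterate_sub_le K (w s)
    have h4 := hH.abs_iterate_sub_le K p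
    rw [show w s + (D s : ℤ) = p by rw [hDw]; ring] at h1
    simp only [hM]
    rw [show w s + (D s : ℤ) = p by rw [hDw]; ring]
    rw [abs_le] at *
    omega
  have hMD : Tendsto (fun s => (M s : ℝ) / D s) atTop (𝓝 ρ) := by
    rw [tendsto_iff_norm_sub_tendsto_zero]
    refine squeeze_zero' (Eventually.of_forall fun s => norm_nonneg _) ?_ (hφ.comp hDtop)
    filter_upwards [eventually_gt_atTop 0] with s hs
    exact hdens (w s) (D s) (hs.trans_le (hDs s))
  have hMr : ∀ s, |(M s : ℝ) - s| ≤ 2 * K := fun s => by exact_mod_cast hMs s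
  have herr : Tendsto (fun s => ((M s : ℝ) - s) / D s) atTop (𝓝 0) := by
    have hlim : Tendsto (fun s => (2 * K : ℝ) / D s) atTop (𝓝 0) :=
      (tendsto_const_div_atTop_nhds_zero_nat (2 * K : ℝ)).comp hDtop
    refine squeeze_zero_norm (fun s => ?_) hlim
    rw [norm_div, Real.norm_eq_abs, Real.norm_eq_abs, Nat.abs_cast]
    exact div_le_div_of_nonneg_right (hMr s) (Nat.cast_nonneg _)
  have hsD : Tendsto (fun s : ℕ => (s : ℝ) / D s) atTop (𝓝 ρ) := by
    have := hMD.sub herr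
    rw [sub_zero] at this
    refine this.congr fun s => ?_
    rw [← sub_div, sub_sub_cancel]
  have hDs' : Tendsto (fun s : ℕ => (D s : ℝ) / s) atTop (𝓝 (1 / ρ)) := by
    rw [one_div]
    exact (hsD.inv₀ hρ.ne').congr fun s => inv_div _ _
  refine tendsto_const_add_div (p - y) (K + 1) (u := fun s => s - D s) ?_
    (backwardTravel X y) fun s => ?_
  · rw [neg_sub]
    refine (hDs'.const_sub 1).congr' ?_
    filter_upwards [eventually_gt_atTop 0] with s hs
    rw [sub_div, div_self (by positivity)]
  · rw [backwardTravel_eq]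
    have h1 : backwardPos X y (K + 1 + s) = p - D s + s := by
      rw [hDw]
      simp only [hw]
      ring
    rw [h1]
    push_cast
    ring

theorem neg_max_of_le_half {ρ : ℝ} (h0 : 0 < ρ) (h : ρ ≤ 1 / 2) :
    -max 1 (1 / ρ - 1) = -(1 / ρ - 1) := by
  rw [max_eq_right]
  have : 2 ≤ 1 / ρ := by rw [le_div_iff₀ h0]; linarith
  linarith

theorem neg_max_of_half_le {ρ : ℝ} (h : 1 / 2 ≤ ρ) : -max 1 (1 / ρ - 1) = -1 := by
  rw [max_eq_left]
  have : 1 / ρ ≤ 2 := by rw [div_le_iff₀ (by linarith)]; linarith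
  linarith

/-- Velocities of tracers on `ℤ` for a positive uniform density, provided that the windows of some
length all lie on the same side of `1 / 2` as the density. -/
theorem tracers_of_uniformDensity {X : Config ℤ} {ρ : ℝ} (hρ : 0 < ρ) (hd : UniformDensity X ρ)
    {K : ℕ} (hK : 0 < K)
    (hle : ρ ≤ 1 / 2 → ∀ n : ℤ, 2 * particlesIn X (n + 1) (n + K) ≤ K)
    (hge : 1 / 2 < ρ → ∀ n : ℤ, K ≤ 2 * particlesIn X (n + 1) (n + K)) (y : ℤ) :
    ForwardMotionDefined X y ∧ BackwardMotionDefined X y ∧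
      (ρ ≤ 1 / 2 → Tendsto (forwardVelocity X y) atTop (𝓝 1)) ∧
      Tendsto (backwardVelocity X y) atTop (𝓝 (-max 1 (1 / ρ - 1))) := by
  have hX := hd.twoSided hρ
  refine ⟨hX.forwardMotionDefined y, hX.backwardMotionDefined y,
    fun h => tendsto_forwardVelocity hX hK (hle h) y, ?_⟩
  rcases le_or_gt ρ (1 / 2) with h | h
  · rw [neg_max_of_le_half hρ h]
    exact tendsto_backwardVelocity_of_free hρ hd hK (hle h) y
  · rw [neg_max_of_half_le h.le]
    exact tendsto_backwardVelocity_of_jammed hX hK (hge h) y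

/-! ### From regularity to windows on one side of one half -/

theorem Regular.uniformDensity {X : Config ℤ} {ρ : ℝ} (h : Regular X ρ) : UniformDensity X ρ := by
  obtain ⟨φ, -, -, h1, h2⟩ := h
  exact ⟨φ, h1, h2⟩

theorem UniformDensity.nonneg {X : Config ℤ} {ρ : ℝ} (h : UniformDensity X ρ) : 0 ≤ ρ := by
  obtain ⟨φ, hφ, hX⟩ := h
  by_contra! hρ
  obtain ⟨k, hk, hk0⟩ :=
    ((hφ.eventually (gt_mem_nhds (neg_pos.2 hρ))).and (eventually_gt_atTop 0)).exists
  have h1 := (abs_le.1 (hX 0 k hk0)).2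
  have h2 : (0 : ℝ) ≤ (particlesIn X (0 + 1) (0 + k) : ℝ) / k := by positivity
  linarith

/-- For long windows the uniform error is smaller than `|ρ - 1 / 2|`. -/
theorem UniformDensity.exists_window {X : Config ℤ} {ρ : ℝ} (h : UniformDensity X ρ)
    (hρ : ρ ≠ 1 / 2) : ∃ K : ℕ, 0 < K ∧
      (ρ ≤ 1 / 2 → ∀ n : ℤ, 2 * particlesIn X (n + 1) (n + K) ≤ K) ∧
      (1 / 2 < ρ → ∀ n : ℤ, K ≤ 2 * particlesIn X (n + 1) (n + K)) := by
  obtain ⟨φ, hφ, hX⟩ := h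
  obtain ⟨k, hk, hk0⟩ := ((hφ.eventually (gt_mem_nhds (abs_pos.2 (sub_ne_zero.2 hρ)))).and
    (eventually_gt_atTop 0)).exists
  have hk' : (0 : ℝ) < k := by exact_mod_cast hk0
  refine ⟨k, hk0, fun h n => ?_, fun h n => ?_⟩
  · rw [abs_of_nonpos (by linarith)] at hk
    have h1 := (abs_le.1 (hX n k hk0)).2
    have h2 : (particlesIn X (n + 1) (n + k) : ℝ) / k ≤ 1 / 2 := by linarith
    rw [div_le_iff₀ hk'] at h2
    have h3 : 2 * (particlesIn X (n + 1) (n + k) : ℝ) ≤ k := by linarith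
    exact_mod_cast h3
  · rw [abs_of_nonneg (by linarith)] at hk
    have h1 := (abs_le.1 (hX n k hk0)).1
    have h2 : 1 / 2 ≤ (particlesIn X (n + 1) (n + k) : ℝ) / k := by linarith
    rw [le_div_iff₀ hk'] at h2
    have h3 : (k : ℝ) ≤ 2 * (particlesIn X (n + 1) (n + k) : ℝ) := by linarith
    exact_mod_cast h3

/-! ### The periodic lattice -/

/-- The periodic configuration on `ℤ` obtained from a configuration on `ZMod N`. -/
def unroll {N : ℕ} (X : Config (ZMod N)) : Config ℤ := fun x => X (x : ZMod N)

section Periodic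

variable {N : ℕ}

theorem slowMap_unroll (X : Config (ZMod N)) : slowMap (unroll X) = unroll (slowMap X) := by
  funext x
  simp [slowMap, unroll]

/-- Distances are natural numbers on both lattices, so the two tracers make identical jumps although
the periodic one is located only modulo `N`. -/
theorem forwardDistances_unroll (X : Config (ZMod N)) (y : ℤ) :
    forwardDistances (unroll X) y = forwardDistances X (y : ZMod N) := by
  simp [forwardDistances, unroll]

theorem backwardDistances_unroll (X : Config (ZMod N)) (y : ℤ) :
    backwardDistances (unroll X) y = backwardDistances X (y : ZMod N) := by
  simp [backwardDistances, unroll]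

theorem skewPlus_iterate_unroll (X : Config (ZMod N)) (y : ℤ) (t : ℕ) :
    skewPlus^[t] (X, (y : ZMod N)) = (slowMap^[t] X, ((forwardPos (unroll X) y t : ℤ) : ZMod N)) ∧
      slowMap^[t] (unroll X) = unroll (slowMap^[t] X) := by
  induction t with
  | zero => exact ⟨rfl, rfl⟩
  | succ t ih =>
    have h : slowMap^[t + 1] (unroll X) = unroll (slowMap^[t + 1] X) := by
      rw [Function.iterate_succ_apply', Function.iterate_succ_apply', ih.2, slowMap_unroll]
    refine ⟨?_, h⟩
    rw [Function.iterate_succ_apply', ih.1, forwardPos_succ, ih.2, skewPlus, tauPlus, tauPlus,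
      forwardJump, forwardJump, forwardDistances_unroll, Function.iterate_succ_apply']
    push_cast
    rfl

theorem skewMinus_iterate_unroll (X : Config (ZMod N)) (y : ℤ) (t : ℕ) :
    skewMinus^[t] (X, (y : ZMod N)) = (slowMap^[t] X, ((backwardPos (unroll X) y t : ℤ) : ZMod N)) := by
  induction t with
  | zero => rfl
  | succ t ih =>
    rw [Function.iterate_succ_apply', ih, backwardPos_succ, (skewPlus_iterate_unroll X y t).2,
      skewMinus, tauMinus, tauMinus, backwardJump, backwardJump, backwardDistances_unroll,
      Function.iterate_succ_apply']
    push_cast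
    rfl

theorem forwardDistances_iterate_unroll (X : Config (ZMod N)) (y : ℤ) (t : ℕ) :
    forwardDistances (skewPlus^[t] (unroll X, y)).1 (skewPlus^[t] (unroll X, y)).2 =
      forwardDistances (skewPlus^[t] (X, (y : ZMod N))).1 (skewPlus^[t] (X, (y : ZMod N))).2 := by
  rw [(skewPlus_iterate_unroll X y t).1, skewPlus_iterate_fst, (skewPlus_iterate_unroll X y t).2,
    forwardDistances_unroll]
  rfl

theorem backwardDistances_iterate_unroll (X : Config (ZMod N)) (y : ℤ) (t : ℕ) :
    backwardDistances (skewMinus^[t] (unroll X, y)).1 (skewMinus^[t] (unroll X, y)).2 =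
      backwardDistances (skewMinus^[t] (X, (y : ZMod N))).1
        (skewMinus^[t] (X, (y : ZMod N))).2 := by
  rw [skewMinus_iterate_unroll X y t, skewMinus_iterate_fst, (skewPlus_iterate_unroll X y t).2,
    backwardDistances_unroll]
  rfl

theorem forwardMotionDefined_unroll (X : Config (ZMod N)) (y : ℤ) :
    ForwardMotionDefined (unroll X) y ↔ ForwardMotionDefined X (y : ZMod N) := by
  simp only [ForwardMotionDefined, forwardDistances_iterate_unroll]

theorem backwardMotionDefined_unroll (X : Config (ZMod N)) (y : ℤ) :
    BackwardMotionDefined (unroll X) y ↔ BackwardMotionDefined X (y : ZMod N) := by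
  simp only [BackwardMotionDefined, backwardDistances_iterate_unroll]

theorem forwardVelocity_unroll (X : Config (ZMod N)) (y : ℤ) :
    forwardVelocity (unroll X) y = forwardVelocity X (y : ZMod N) := by
  funext t
  simp only [forwardVelocity, forwardTravel, forwardJump, forwardDistances_iterate_unroll]

theorem backwardVelocity_unroll (X : Config (ZMod N)) (y : ℤ) :
    backwardVelocity (unroll X) y = backwardVelocity X (y : ZMod N) := by
  funext t
  simp only [backwardVelocity, backwardTravel, backwardJump, backwardDistances_iterate_unroll]

theorem particlesIn_unroll_period [NeZero N] (X : Config (ZMod N)) (n : ℤ) :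
    particlesIn (unroll X) (n + 1) (n + N) = particles X := by
  refine Finset.card_bij (fun x _ => (x : ZMod N)) (fun x hx => ?_) (fun a ha b hb hab => ?_)
    (fun z hz => ?_)
  · simpa [unroll] using (Finset.mem_filter.1 hx).2
  · rw [Finset.mem_filter, Finset.mem_Icc] at ha hb
    obtain ⟨c, hc⟩ := (ZMod.intCast_eq_intCast_iff_dvd_sub _ _ _).1 hab
    have hN : (0 : ℤ) < N := by exact_mod_cast NeZero.pos N
    have h1 : c < 1 := by nlinarith
    have h2 : -1 < c := by nlinarith
    obtain rfl : c = 0 := by omega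
    omega
  · have hN : (0 : ℤ) < N := by exact_mod_cast NeZero.pos N
    have h0 := Int.emod_nonneg ((z.val : ℤ) - (n + 1)) hN.ne'
    have h1 := Int.emod_lt_of_pos ((z.val : ℤ) - (n + 1)) hN
    have hcast : ((n + 1 + ((z.val : ℤ) - (n + 1)) % N : ℤ) : ZMod N) = z := by
      push_cast
      simp
    refine ⟨n + 1 + ((z.val : ℤ) - (n + 1)) % N, ?_, hcast⟩
    rw [Finset.mem_filter, Finset.mem_Icc, unroll, hcast]
    exact ⟨⟨by omega, by omega⟩, (Finset.mem_filter.1 hz).2⟩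

/-- With `k = N * q + r` and `r ≤ N`, the count and `density X * k` both lie between `m(X) * q` and
`m(X) * q + N`, whence the rate `N / k`. -/
theorem uniformDensity_unroll [NeZero N] (X : Config (ZMod N)) :
    UniformDensity (unroll X) (density X) := by
  refine ⟨fun k => N / k, tendsto_const_div_atTop_nhds_zero_nat _, fun n k hk => ?_⟩
  obtain ⟨H, hH⟩ := exists_isHeight (unroll X)
  have hN : 0 < N := NeZero.pos N
  have hper : ∀ q : ℕ, ∀ n, H (n + N * q) = H n + particles X * q := by
    intro q
    induction q with
    | zero => simp
    | succ q ih =>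
      intro n
      have h1 := hH.particlesIn_eq (n + N * q) N
      rw [particlesIn_unroll_period, ih] at h1
      rw [show n + (N : ℤ) * ((q + 1 : ℕ) : ℤ) = n + N * q + N by push_cast; ring]
      push_cast
      linarith
  have h1 := hH.particlesIn_eq n k
  have hk' : (k : ℤ) = N * (k / N : ℕ) + (k % N : ℕ) := by exact_mod_cast (Nat.div_add_mod k N).symm
  have h2 := hper (k / N) n
  have h3 := hH.add_natCast_le (n + N * (k / N : ℕ)) (k % N)
  rw [add_assoc n, ← hk', h2] at h3
  have hr : (k % N : ℕ) ≤ N := (Nat.mod_lt k hN).le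
  have hm : particles X ≤ N := by
    refine (Finset.card_le_univ _).trans ?_
    rw [ZMod.card]
  have hkr : (k : ℝ) = N * (k / N : ℕ) + (k % N : ℕ) := by exact_mod_cast hk'
  have hlo : (particles X : ℝ) * (k / N : ℕ) ≤ particlesIn (unroll X) (n + 1) (n + k) := by
    have : (particles X : ℤ) * (k / N : ℕ) ≤ particlesIn (unroll X) (n + 1) (n + k) := by linarith
    exact_mod_cast this
  have hhi : (particlesIn (unroll X) (n + 1) (n + k) : ℝ) ≤
      particles X * (k / N : ℕ) + (k % N : ℕ) := by
    have : (particlesIn (unroll X) (n + 1) (n + k) : ℤ) ≤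
      particles X * (k / N : ℕ) + (k % N : ℕ) := by linarith
    exact_mod_cast this
  have hkpos : (0 : ℝ) < k := by exact_mod_cast hk
  have hNpos : (0 : ℝ) < N := by exact_mod_cast hN
  have hd0 : 0 ≤ density X := by rw [density]; positivity
  have hd1 : density X ≤ 1 := by
    rw [density, div_le_one hNpos]
    exact_mod_cast hm
  have hdN : (particles X : ℝ) = density X * N := by rw [density]; field_simp
  have hr0 : (0 : ℝ) ≤ (k % N : ℕ) := Nat.cast_nonneg _
  have hr1 : ((k % N : ℕ) : ℝ) ≤ N := by exact_mod_cast hr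
  have hdk : density X * k = particles X * (k / N : ℕ) + density X * (k % N : ℕ) := by
    rw [hdN, hkr]
    ring
  have h4 : density X * (k % N : ℕ) ≤ N :=
    (mul_le_of_le_one_left hr0 hd1).trans hr1
  have h5 : 0 ≤ density X * (k % N : ℕ) := mul_nonneg hd0 hr0
  have hrw : (particlesIn (unroll X) (n + 1) (n + k) : ℝ) / k - density X =
      (particlesIn (unroll X) (n + 1) (n + k) - density X * k) / k := by
    field_simp
  rw [hrw, abs_div, abs_of_pos hkpos]
  refine div_le_div_of_nonneg_right (abs_le.2 ⟨?_, ?_⟩) hkpos.le <;> linarith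

end Periodic

end Traffic

theorem mainTheorem4 :
    (∀ (N : ℕ) [NeZero N] (X : Traffic.Config (ZMod N)) (y : ZMod N), 1 < Traffic.particles X →
      Traffic.ForwardMotionDefined X y ∧ Traffic.BackwardMotionDefined X y ∧
      (Traffic.density X ≤ 1 / 2 →
        Tendsto (Traffic.forwardVelocity X y) atTop (𝓝 1)) ∧
      Tendsto (Traffic.backwardVelocity X y) atTop
        (𝓝 (-max 1 (1 / Traffic.density X - 1)))) ∧
    (∀ (X : Traffic.Config ℤ) (ρ : ℝ) (y : ℤ), Traffic.Regular X ρ →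
      ρ ∉ ({0, 1 / 2, 1} : Set ℝ) →
      Traffic.ForwardMotionDefined X y ∧ Traffic.BackwardMotionDefined X y ∧
      (ρ ≤ 1 / 2 → Tendsto (Traffic.forwardVelocity X y) atTop (𝓝 1)) ∧
      Tendsto (Traffic.backwardVelocity X y) atTop (𝓝 (-max 1 (1 / ρ - 1)))) := by
  refine ⟨fun N _ X y hX => ?_, fun X ρ y hX hρ => ?_⟩
  · obtain ⟨z, rfl⟩ := ZMod.intCast_surjective y
    have hN : (0 : ℝ) < N := by exact_mod_cast NeZero.pos N
    have hd : 0 < Traffic.density X :=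
      div_pos (by exact_mod_cast (zero_lt_one.trans hX)) hN
    rw [← Traffic.forwardMotionDefined_unroll, ← Traffic.backwardMotionDefined_unroll,
      ← Traffic.forwardVelocity_unroll, ← Traffic.backwardVelocity_unroll]
    -- The window is one full period, whose count is exact, so no gap between the density and `1 /
    -- 2` is needed.
    refine Traffic.tracers_of_uniformDensity hd (Traffic.uniformDensity_unroll X) (NeZero.pos N)
      (fun h n => ?_) (fun h n => ?_) z
    · rw [Traffic.particlesIn_unroll_period]
      rw [Traffic.density, div_le_iff₀ hN] at h
      have : 2 * (Traffic.particles X : ℝ) ≤ N := by linarith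
      exact_mod_cast this
    · rw [Traffic.particlesIn_unroll_period]
      rw [Traffic.density, lt_div_iff₀ hN] at h
      have : (N : ℝ) ≤ 2 * (Traffic.particles X : ℝ) := by linarith
      exact_mod_cast this
  · simp only [Set.mem_insert_iff, Set.mem_singleton_iff, not_or] at hρ
    have hd := hX.uniformDensity
    obtain ⟨K, hK, hle, hge⟩ := hd.exists_window hρ.2.1
    exact Traffic.tracers_of_uniformDensity (hd.nonneg.lt_of_ne' hρ.1) hd hK hle hge y
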